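/- Let $0<p\le 1$ and let $H$ be a complex Hilbert space. Define $F_3$ on $(0,\infty)^3$ by \[ F_3(t_1,t_2,t_3)=\begin{cases}\dfrac{t_1^{p+1}-t_2^{p+1}}{t_1-t_2}\,t_3^{1-p}, & t_1\neq t_2,\\[2ex] (p+1)\,t_1^{p}\,t_3^{1-p}, & t_1=t_2.\end{cases} \] Let $\mathcal D_+^k$ be the set of $k$-tuples of positive definite invertible operators in $B(H)$. For commuting self-adjoint $X_1,\dots,X_k\in B(H)$ and a real function $f$, continuous on a product of intervals containing the spectra, $f(X_1,\dots,X_k)\in B(H)$ denotes the joint functional calculus; if $H$ is finite-dimensional, $f(X_1,\dots,X_k)=\sum f(\lambda_1,\dots,\lambda_k)P_1\cdots P_k$, summed over the eigenvalues $\lambda_m$ of $X_m$ with spectral projections $P_m$. Then: (i) $F_3$ extends to a concave map on triples of positive definite invertible operators: there is a map $\Phi:\mathcal D_+^3\to B(H)$ with self-adjoint values that is concave in the operator order, and satisfies $\Phi(A,B,C)=F_3(A,B,C)$ whenever $A,B,C$ commute. (ii) In particular, $F_3$ is operator concave: for arbitrary C$^*$-subalgebras $\mathcal A_1,\mathcal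 A_2,\mathcal A_3$ of $B(H)$ that commute with one another, the map $(X_1,X_2,X_3)\mapsto F_3(X_1,X_2,X_3)$ is concave on the triples of self-adjoint operators $X_m\in\mathcal A_m$ with spectra in $(0,\infty)$. (iii) The case $t_1=t_2$ gives Lieb's concavity theorem: if $H$ is finite-dimensional, then for every $K\in B(H)$ the map $(A,C)\mapsto \operatorname{Tr}\bigl(K^*A^{p}KC^{1-p}\bigr)$ is concave on $\mathcal D_+^2$. -/

import Mathlib

/-! ### The functional calculus for commuting tuples of self-adjoint elements -/

section JointCalculus

variable {A : Type*} [CStarAlgebra A] {k : ℕ}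

/-- The unital C⋆-algebra generated by a tuple. -/
def jointAlgebra (X : Fin k → A) : StarSubalgebra ℂ A :=
  (StarAlgebra.adjoin ℂ (Set.range X)).topologicalClosure

theorem mem_jointAlgebra (X : Fin k → A) (i : Fin k) : X i ∈ jointAlgebra X :=
  StarSubalgebra.le_topologicalClosure _
    (StarAlgebra.subset_adjoin ℂ (Set.range X) (Set.mem_range_self i))

theorem jointAlgebra_isClosed (X : Fin k → A) : IsClosed (jointAlgebra X : Set A) :=
  StarSubalgebra.isClosed_topologicalClosure _

/-- A tuple of pairwise commuting self-adjoint elements. -/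
def IsCommutingSelfAdjoint (X : Fin k → A) : Prop :=
  (∀ i, IsSelfAdjoint (X i)) ∧ ∀ i j, Commute (X i) (X j)

theorem jointAlgebra_mul_comm {X : Fin k → A} (h : IsCommutingSelfAdjoint X)
    (a b : jointAlgebra X) : a * b = b * a := by
  have hs : ∀ x ∈ Set.range X, ∀ y ∈ Set.range X, x * y = y * x := by
    rintro _ ⟨i, rfl⟩ _ ⟨j, rfl⟩
    exact h.2 i j
  have hs' : ∀ x ∈ Set.range X, ∀ y ∈ Set.range X, x * star y = star y * x := by
    rintro _ ⟨i, rfl⟩ _ ⟨j, rfl⟩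
    rw [(h.1 j).star_eq]
    exact h.2 i j
  have hc := StarAlgebra.isMulCommutative_adjoin ℂ hs hs'
  let _ : CommRing (jointAlgebra X) :=
    StarSubalgebra.commRingTopologicalClosure (StarAlgebra.adjoin ℂ (Set.range X))
      (fun x y => hc.is_comm.comm x y)
  exact mul_comm a b

/-- The C⋆-algebra generated by commuting self-adjoint elements, as a commutative C⋆-algebra. -/
noncomputable abbrev jointAlgebraCommCStarAlgebra {X : Fin k → A}
    (h : IsCommutingSelfAdjoint X) : CommCStarAlgebra (jointAlgebra X) :=
  { StarSubalgebra.cstarAlgebra (jointAlgebra X) (h_closed := jointAlgebra_isClosed X) with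
    mul_comm := jointAlgebra_mul_comm h }

open scoped Classical in
/-- The functional calculus `f (X₁, …, X_k)` for commuting self-adjoint `X₁, …, X_k`: the element
of the commutative C⋆-algebra generated by the `Xᵢ` whose Gelfand transform is
`φ ↦ f (φ X₁, …, φ X_k)`. (The numbers `φ Xᵢ` are real.) It is defined as soon as this function is
continuous on the character space, which is automatic in finite dimension; there
`f (X₁, …, X_k) = ∑ f (λ₁, …, λ_k) P₁ ⋯ P_k` over the spectral projections. The value is `0` when
the tuple is not commuting self-adjoint or the function is not continuous. -/
noncomputable def jointCFC (f : (Fin k → ℝ) → ℝ) (X : Fin k → A) : A :=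
  if h : IsCommutingSelfAdjoint X then
    letI := jointAlgebraCommCStarAlgebra h
    if hc : Continuous (fun φ : WeakDual.characterSpace ℂ (jointAlgebra X) =>
        ((f fun i => (φ ⟨X i, mem_jointAlgebra X i⟩).re : ℝ) : ℂ)) then
      (((gelfandStarTransform (jointAlgebra X)).symm ⟨_, hc⟩ : jointAlgebra X) : A)
    else 0
  else 0

end JointCalculus

/-! ### Operator concavity -/

/-- A real function `f` of `k` variables on the box `I₁ × ⋯ × I_k` is operator concave on the
Hilbert space `H` if, for arbitrary commuting C⋆-subalgebras `𝒜₁, …, 𝒜_k` of `B(H)`, the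
functional calculus by `f` is concave on the tuples of self-adjoint `Xᵢ ∈ 𝒜ᵢ` with spectrum in
`Iᵢ`. The algebras commute with one another, they need not be commutative. -/
def OperatorConcaveOn (H : Type*) [NormedAddCommGroup H] [InnerProductSpace ℂ H] [CompleteSpace H]
    {k : ℕ} (I : Fin k → Set ℝ) (f : (Fin k → ℝ) → ℝ) : Prop :=
  ∀ 𝒜 : Fin k → NonUnitalStarSubalgebra ℂ (H →L[ℂ] H),
    (∀ i, IsClosed (𝒜 i : Set (H →L[ℂ] H))) →
    (∀ i j, i ≠ j → ∀ a ∈ 𝒜 i, ∀ b ∈ 𝒜 j, Commute a b) →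
    ConcaveOn ℝ
      {X : Fin k → (H →L[ℂ] H) |
        ∀ i, X i ∈ 𝒜 i ∧ IsSelfAdjoint (X i) ∧ spectrum ℝ (X i) ⊆ I i}
      (jointCFC f)

/-! ### The function of three variables -/

/-- `(t₁ ^ (p+1) - t₂ ^ (p+1)) / (t₁ - t₂) * t₃ ^ (1-p)`, continuously extended to `t₁ = t₂`. -/
noncomputable def threeVarFun (p : ℝ) (t : Fin 3 → ℝ) : ℝ :=
  if t 0 = t 1 then (p + 1) * t 0 ^ p * t 2 ^ (1 - p)
  else (t 0 ^ (p + 1) - t 1 ^ (p + 1)) / (t 0 - t 1) * t 2 ^ (1 - p)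

/-- The `k`-tuples of positive definite invertible operators on `H`. -/
def posTuples (H : Type*) [NormedAddCommGroup H] [InnerProductSpace ℂ H] [CompleteSpace H]
    (k : ℕ) : Set (Fin k → (H →L[ℂ] H)) :=
  {X | ∀ i, IsStrictlyPositive (X i)}

/-!
The function `(t₁^(p+1) - t₂^(p+1)) / (t₁ - t₂) · t₃^(1-p)` equals
`(p + 1) ∫₀¹ (s t₁ + (1 - s) t₂)^p t₃^(1-p) ds` (`threeVarFun_eq_integral`). The integrand is the
weighted geometric mean of `t₃` and `s t₁ + (1 - s) t₂`, which extends to pairs of positive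
invertible operators, `c #ₚ a = c^(1/2) (c^(-1/2) a c^(-1/2))^p c^(1/2)` (`geomMean`). So
`Φ(a, b, c) = (p + 1) ∫₀¹ c #ₚ (s a + (1 - s) b) ds` (`segmentMean`) extends the function.

The geometric mean is jointly concave (`concaveOn_geomMean`): inserting the integral representation
of `x^p` writes it as an integral over `t > 0` of positive multiples of `t⁻¹ c - c (t c + a)⁻¹ c`,
and `(T, S) ↦ T⋆ S⁻¹ T` is jointly convex (`convexOn_star_mul_ringInverse_mul`). Since
`s a + (1 - s) b` is linear in `(a, b)`, concavity of `Φ` follows by integration.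

That `Φ` agrees with the joint functional calculus on commuting triples is checked at the characters
of the commutative C⋆-algebra generated by the triple (`segmentMean_eq_jointCFC`). Operator
concavity is then concavity of `Φ` restricted to triples from commuting algebras.

For Lieb's theorem, left multiplication by `A` and right multiplication by `C` are commuting
positive operators on the Hilbert–Schmidt space of `H`, linear in `A` and `C`. Their geometric
mean is `X ↦ A^p X C^(1-p)`, whose quadratic form at `K` is the trace in question
(`inner_geomMean_eq_trace`).
-/

/-! ### Joint concavity of the weighted geometric mean -/

section GeometricMean

open Set MeasureTheory

variable {B : Type*} [CStarAlgebra B] [PartialOrder B] [StarOrderedRing B]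

theorem convex_isStrictlyPositive : Convex ℝ {a : B | IsStrictlyPositive a} := by
  grind [convex_iff_forall_pos]

/-- The lower bounds of which `T⋆ S⁻¹ T` is the supremum over `Y`; they are affine in `(T, S)`, and
the bound is attained at `Y = S⁻¹ T`. -/
theorem add_sub_le_star_mul_ringInverse_mul {S : B} (hS : IsStrictlyPositive S) (T Y : B) :
    star T * Y + star Y * T - star Y * S * Y ≤ star T * Ring.inverse S * T := by
  have h0 : 0 ≤ star (T - S * Y) * Ring.inverse S * (T - S * Y) :=
    star_left_conjugate_nonneg hS.ringInverse.nonneg _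
  have hs : star S = S := hS.isSelfAdjoint.star_eq
  have h1 : S * Ring.inverse S = 1 := Ring.mul_inverse_cancel S hS.isUnit
  have h2 : Ring.inverse S * S = 1 := Ring.inverse_mul_cancel S hS.isUnit
  have : star (T - S * Y) * Ring.inverse S * (T - S * Y) =
      star T * Ring.inverse S * T - (star T * Y + star Y * T - star Y * S * Y) := by
    calc _ = star T * Ring.inverse S * T - star T * (Ring.inverse S * S) * Y
            - star Y * (S * Ring.inverse S) * T
            + star Y * (S * Ring.inverse S) * S * Y := by
          rw [star_sub, star_mul, hs]; noncomm_ring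
      _ = _ := by rw [h1, h2]; noncomm_ring
  rw [this] at h0
  exact sub_nonneg.mp h0

/-- Joint convexity of `(T, S) ↦ T⋆ S⁻¹ T`, as a supremum of affine functions. -/
theorem convexOn_star_mul_ringInverse_mul :
    ConvexOn ℝ {x : B × B | IsStrictlyPositive x.2}
      (fun x => star x.1 * Ring.inverse x.2 * x.1) := by
  have hc : Convex ℝ {x : B × B | IsStrictlyPositive x.2} :=
    (convex_isStrictlyPositive (B := B)).is_linear_preimage
      (LinearMap.snd ℝ B B).isLinear
  refine ⟨hc, ?_⟩
  rintro ⟨T₁, S₁⟩ h₁ ⟨T₂, S₂⟩ h₂ a b ha hb hab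
  have hS : IsStrictlyPositive (a • S₁ + b • S₂) := hc h₁ h₂ ha hb hab
  simp only [mem_ofPred_eq, Prod.smul_mk, Prod.mk_add_mk] at h₁ h₂ ⊢
  set T := a • T₁ + b • T₂ with hT
  set S := a • S₁ + b • S₂ with hSdef
  -- The value of `Y` at which the affine lower bound at the convex combination is attained.
  set Y := Ring.inverse S * T with hY
  have e : star T * Ring.inverse S * T = star T * Y + star Y * T - star Y * S * Y := by
    have hi : star (Ring.inverse S) = Ring.inverse S := hS.ringInverse.isSelfAdjoint.star_eq
    have h2 : Ring.inverse S * S = 1 := Ring.inverse_mul_cancel S hS.isUnit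
    have : star Y * S * Y = star T * (Ring.inverse S * S) * (Ring.inverse S * T) := by
      rw [hY, star_mul, hi]; noncomm_ring
    rw [this, h2, hY, star_mul, hi]; noncomm_ring
  rw [e]
  have k₁ := smul_le_smul_of_nonneg_left (add_sub_le_star_mul_ringInverse_mul h₁ T₁ Y) ha
  have k₂ := smul_le_smul_of_nonneg_left (add_sub_le_star_mul_ringInverse_mul h₂ T₂ Y) hb
  refine le_trans (le_of_eq ?_) (add_le_add k₁ k₂)
  rw [hT, hSdef]
  simp only [star_add, star_smul, star_trivial, add_mul, mul_add, smul_mul_assoc, mul_smul_comm,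
    smul_sub, smul_add]
  abel

/-- The weighted operator geometric mean `c #ₚ a = c^(1/2) (c^(-1/2) a c^(-1/2))^p c^(1/2)`, that is
`a^p c^(1-p)` when `a` and `c` commute. It is meaningful for strictly positive `a` and `c`. -/
noncomputable def geomMean (p : ℝ) (a c : B) : B :=
  c ^ (1 / 2 : ℝ) * (c ^ (-(1 / 2) : ℝ) * a * c ^ (-(1 / 2) : ℝ)) ^ p * c ^ (1 / 2 : ℝ)

theorem isStrictlyPositive_conj_rpow_neg_half {a c : B} (ha : IsStrictlyPositive a)
    (hc : IsStrictlyPositive c) :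
    IsStrictlyPositive (c ^ (-(1 / 2) : ℝ) * a * c ^ (-(1 / 2) : ℝ)) :=
  IsStrictlyPositive.conjugate_of_isUnit_of_isSelfAdjoint _ _ (hc.rpow c _).isUnit
    (hc.rpow c _).isSelfAdjoint ha

theorem rpow_half_mul_rpow_half {c : B} (hc : IsStrictlyPositive c) :
    c ^ (1 / 2 : ℝ) * c ^ (1 / 2 : ℝ) = c := by
  rw [← CFC.rpow_add hc.isUnit]; norm_num; exact CFC.rpow_one c hc.nonneg

theorem cfcₙ_rpowIntegrand₀₁_eq {p t : ℝ} (hp : p ∈ Ioo 0 1) (ht : 0 < t) {x : B} (hx : 0 ≤ x) :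
    cfcₙ (Real.rpowIntegrand₀₁ p t) x =
      algebraMap ℝ B (t ^ (p - 1)) - t ^ p • Ring.inverse (algebraMap ℝ B t + x) := by
  rw [cfcₙ_eq_cfc (hf := (Real.continuousOn_rpowIntegrand₀₁_Ici hp ht).mono (by grind))
    (hf0 := by simp)]
  rw [Real.rpowIntegrand₀₁_eq_sub hp.2.ne ht]
  have hspec : ∀ r ∈ spectrum ℝ x, t + r ≠ 0 := fun r hr =>
    (add_pos_of_pos_of_nonneg ht (spectrum_nonneg_of_nonneg hx hr)).ne'
  have hid : ContinuousOn (fun z : ℝ => t + z) (spectrum ℝ x) := by fun_prop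
  have hg : ContinuousOn (fun z : ℝ => (t + z)⁻¹) (spectrum ℝ x) := hid.inv₀ hspec
  have hsa : IsSelfAdjoint x := hx.isSelfAdjoint
  rw [cfc_sub (fun _ : ℝ => t ^ (p - 1)) (fun z : ℝ => t ^ p * (t + z)⁻¹) x
      continuousOn_const (hg.const_mul _),
    cfc_const _ x hsa, cfc_const_mul _ _ x hg, cfc_inv _ x hspec hid hsa,
    cfc_const_add t (fun z => z) x continuousOn_id hsa, cfc_id' ℝ x hsa]

/-- Conjugating the integrand of the integral representation of `x ↦ x ^ p` by `c ^ (1/2)` gives an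
expression in `a` and `c` without fractional powers of them. -/
theorem conj_cfcₙ_rpowIntegrand₀₁_eq {p t : ℝ} (hp : p ∈ Ioo 0 1) (ht : 0 < t) {a c : B}
    (ha : IsStrictlyPositive a) (hc : IsStrictlyPositive c) :
    c ^ (1 / 2 : ℝ) * cfcₙ (Real.rpowIntegrand₀₁ p t)
        (c ^ (-(1 / 2) : ℝ) * a * c ^ (-(1 / 2) : ℝ)) * c ^ (1 / 2 : ℝ) =
      t ^ (p - 1) • c - t ^ p • (star c * Ring.inverse (t • c + a) * c) := by
  have hx := isStrictlyPositive_conj_rpow_neg_half ha hc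
  rw [cfcₙ_rpowIntegrand₀₁_eq hp ht hx.nonneg]
  set h := c ^ (1 / 2 : ℝ) with hh
  set k := c ^ (-(1 / 2) : ℝ) with hk
  have hhh : h * h = c := rpow_half_mul_rpow_half hc
  have hhk : h * k = 1 := CFC.rpow_mul_rpow_neg _ hc
  have hkh : k * h = 1 := CFC.rpow_neg_mul_rpow _ hc
  have hS : IsStrictlyPositive (t • c + a) := by
    have : 0 ≤ t • c := smul_nonneg ht.le hc.nonneg
    grind
  have hinv : Ring.inverse (algebraMap ℝ B t + k * a * k) = h * Ring.inverse (t • c + a) * h := by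
    have e : algebraMap ℝ B t + k * a * k = k * (t • c + a) * k := by
      have : k * c * k = 1 := by
        rw [← hhh, ← mul_assoc, hkh, one_mul, hhk]
      rw [mul_add, add_mul, mul_smul_comm, smul_mul_assoc, this, Algebra.algebraMap_eq_smul_one]
    rw [e]
    have h1 : (k * (t • c + a) * k) * (h * Ring.inverse (t • c + a) * h) = 1 := by
      calc _ = k * ((t • c + a) * (k * h) * Ring.inverse (t • c + a)) * h := by noncomm_ring
        _ = 1 := by rw [hkh, mul_one, Ring.mul_inverse_cancel _ hS.isUnit, mul_one, hkh]
    have h2 : (h * Ring.inverse (t • c + a) * h) * (k * (t • c + a) * k) = 1 := by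
      calc _ = h * (Ring.inverse (t • c + a) * (h * k) * (t • c + a)) * k := by noncomm_ring
        _ = 1 := by rw [hhk, mul_one, Ring.inverse_mul_cancel _ hS.isUnit, mul_one, hhk]
    exact Ring.inverse_unit ⟨_, _, h1, h2⟩
  rw [hinv, hc.isSelfAdjoint.star_eq, Algebra.algebraMap_eq_smul_one]
  simp only [mul_sub, sub_mul, mul_smul_comm, smul_mul_assoc, mul_one, hhh]
  congr 2
  calc _ = (h * h) * Ring.inverse (t • c + a) * (h * h) := by noncomm_ring
    _ = _ := by rw [hhh]

/-- Joint concavity of the weighted geometric mean. For `p < 1`, the integral representation of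
`x ↦ x ^ p` exhibits it as an integral of functions `(a, c) ↦ α c - β c (t c + a)⁻¹ c` with
`0 ≤ β`. -/
theorem concaveOn_geomMean {p : ℝ} (hp0 : 0 < p) (hp1 : p ≤ 1) :
    ConcaveOn ℝ {x : B × B | IsStrictlyPositive x.1 ∧ IsStrictlyPositive x.2}
      (fun x => geomMean p x.1 x.2) := by
  have hconv : Convex ℝ {x : B × B | IsStrictlyPositive x.1 ∧ IsStrictlyPositive x.2} :=
    ((convex_isStrictlyPositive (B := B)).is_linear_preimage (LinearMap.fst ℝ B B).isLinear).inter
      ((convex_isStrictlyPositive (B := B)).is_linear_preimage (LinearMap.snd ℝ B B).isLinear)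
  rcases hp1.lt_or_eq with hp1 | rfl
  · have hp : p ∈ Ioo (0 : ℝ) 1 := ⟨hp0, hp1⟩
    let q : NNReal := ⟨p, hp0.le⟩
    obtain ⟨μ, hμ⟩ := CFC.exists_measure_nnrpow_eq_integral_cfcₙ_rpowIntegrand₀₁ B
      (p := q) ⟨hp0, hp1⟩
    let L (c : B) : B →L[ℝ] B :=
      (ContinuousLinearMap.mul ℝ B (c ^ (1 / 2 : ℝ))).comp
        ((ContinuousLinearMap.mul ℝ B).flip (c ^ (1 / 2 : ℝ)))
    have hL (c x : B) : L c x = c ^ (1 / 2 : ℝ) * x * c ^ (1 / 2 : ℝ) := by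
      simp [L, mul_assoc]
    let F (t : ℝ) (x : B × B) : B := x.2 ^ (1 / 2 : ℝ) * cfcₙ (Real.rpowIntegrand₀₁ p t)
        (x.2 ^ (-(1 / 2) : ℝ) * x.1 * x.2 ^ (-(1 / 2) : ℝ)) * x.2 ^ (1 / 2 : ℝ)
    have hint : ∀ x ∈ {x : B × B | IsStrictlyPositive x.1 ∧ IsStrictlyPositive x.2},
        IntegrableOn (F · x) (Ioi 0) μ ∧ geomMean p x.1 x.2 = ∫ t in Ioi 0, F t x ∂μ := by
      rintro ⟨a, c⟩ ⟨ha, hc⟩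
      obtain ⟨h1, h2⟩ := hμ _ (isStrictlyPositive_conj_rpow_neg_half ha hc).nonneg
      have h3 := (L c).integrable_comp h1
      have h4 := (L c).integral_comp_comm h1
      simp only [hL] at h3 h4
      refine ⟨h3, ?_⟩
      rw [geomMean, ← show ((q : ℝ)) = p from rfl, ← CFC.nnrpow_eq_rpow hp0, h2]
      exact h4.symm
    refine ConcaveOn.congr ?_ fun x hx => (hint x hx).2.symm
    refine integral_concaveOn_of_integrand_ae hconv ?_ fun x hx => (hint x hx).1
    filter_upwards [ae_restrict_mem measurableSet_Ioi] with t (ht : 0 < t)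
    refine ConcaveOn.congr (f := fun x : B × B => t ^ (p - 1) • x.2 -
      t ^ p • (star x.2 * Ring.inverse (t • x.2 + x.1) * x.2)) ?_
      fun x hx => (conj_cfcₙ_rpowIntegrand₀₁_eq hp ht hx.1 hx.2).symm
    refine ConcaveOn.sub ?_ (ConvexOn.smul (by positivity) ?_)
    · exact (t ^ (p - 1) • LinearMap.snd ℝ B B).concaveOn hconv
    · let g : B × B →ₗ[ℝ] B × B :=
        (LinearMap.snd ℝ B B).prod (t • LinearMap.snd ℝ B B + LinearMap.fst ℝ B B)
      refine (convexOn_star_mul_ringInverse_mul.comp_linearMap g).subset ?_ hconv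
      rintro ⟨a, c⟩ ⟨ha, hc⟩
      have : 0 ≤ t • c := smul_nonneg ht.le hc.nonneg
      change IsStrictlyPositive (t • c + a)
      grind
  -- For `p = 1` the geometric mean is the linear map `(a, c) ↦ a`.
  · refine ConcaveOn.congr ((LinearMap.fst ℝ B B).concaveOn hconv) ?_
    rintro ⟨a, c⟩ ⟨ha, hc⟩
    simp only [geomMean, LinearMap.fst_apply]
    rw [CFC.rpow_one _ (isStrictlyPositive_conj_rpow_neg_half ha hc).nonneg]
    set h := c ^ (1 / 2 : ℝ) with hh
    set k := c ^ (-(1 / 2) : ℝ) with hk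
    have hhk : h * k = 1 := CFC.rpow_mul_rpow_neg _ hc
    have hkh : k * h = 1 := CFC.rpow_neg_mul_rpow _ hc
    calc a = (h * k) * a * (k * h) := by rw [hhk, hkh, one_mul, mul_one]
      _ = _ := by noncomm_ring

theorem geomMean_nonneg (p : ℝ) (a c : B) : 0 ≤ geomMean p a c :=
  IsSelfAdjoint.conjugate_nonneg CFC.rpow_nonneg (CFC.rpow_nonneg.isSelfAdjoint)

end GeometricMean

/-! ### The extension of the function of three variables -/

section SegmentMean

open Set MeasureTheory

variable {B : Type*} [CStarAlgebra B] [PartialOrder B] [StarOrderedRing B]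

theorem continuousOn_cstar_rpow {p : ℝ} (hp : 0 < p) :
    ContinuousOn (fun a : B => a ^ p) (Ici 0) := by
  refine ContinuousOn.congr (f := cfc (fun x : ℝ => x ^ p)) ?_ fun a ha =>
    CFC.rpow_eq_cfc_real ha
  exact ContinuousOn.cfc_of_mem_nhdsSet (s := univ) _ Filter.univ_mem continuousOn_id
    (fun a ha => IsSelfAdjoint.of_nonneg ha) (Real.continuous_rpow_const hp.le).continuousOn

theorem segment_isStrictlyPositive {a b : B} (ha : IsStrictlyPositive a)
    (hb : IsStrictlyPositive b) {s : ℝ} (hs : s ∈ Icc (0 : ℝ) 1) :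
    IsStrictlyPositive (s • a + (1 - s) • b) :=
  convex_isStrictlyPositive ha hb hs.1 (sub_nonneg.mpr hs.2) (by ring)

/-- `(p + 1) ∫₀¹ c #ₚ (s a + (1 - s) b) ds` for the triple `X = (a, b, c)`: the extension of
`threeVarFun p` to triples of strictly positive elements that need not commute. -/
noncomputable def segmentMean (p : ℝ) (X : Fin 3 → B) : B :=
  (p + 1) • ∫ s in Icc (0 : ℝ) 1, geomMean p (s • X 0 + (1 - s) • X 1) (X 2)

theorem integrableOn_geomMean_segment {p : ℝ} (hp : 0 < p) {a b : B} (c : B)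
    (ha : IsStrictlyPositive a) (hb : IsStrictlyPositive b) :
    IntegrableOn (fun s : ℝ => geomMean p (s • a + (1 - s) • b) c) (Icc (0 : ℝ) 1) := by
  refine ContinuousOn.integrableOn_Icc ?_
  unfold geomMean
  refine (continuousOn_const.mul ?_).mul continuousOn_const
  refine (continuousOn_cstar_rpow hp).comp (t := Ici 0) (by fun_prop) fun s hs => ?_
  exact IsSelfAdjoint.conjugate_nonneg (segment_isStrictlyPositive ha hb hs).nonneg
    CFC.rpow_nonneg.isSelfAdjoint

theorem concaveOn_segmentMean {p : ℝ} (hp0 : 0 < p) (hp1 : p ≤ 1) :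
    ConcaveOn ℝ {X : Fin 3 → B | ∀ i, IsStrictlyPositive (X i)} (segmentMean p) := by
  have hconv : Convex ℝ {X : Fin 3 → B | ∀ i, IsStrictlyPositive (X i)} :=
    fun X hX Y hY a b ha hb hab i => convex_isStrictlyPositive (hX i) (hY i) ha hb hab
  refine ConcaveOn.smul (by linarith) ?_
  refine integral_concaveOn_of_integrand_ae hconv ?_ fun X hX =>
    integrableOn_geomMean_segment hp0 (X 2) (hX 0) (hX 1)
  filter_upwards [ae_restrict_mem measurableSet_Icc] with s hs
  let g : (Fin 3 → B) →ₗ[ℝ] B × B :=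
    LinearMap.prod (s • LinearMap.proj 0 + (1 - s) • LinearMap.proj 1) (LinearMap.proj 2)
  exact ((concaveOn_geomMean (B := B) hp0 hp1).comp_linearMap g).subset
    (fun X (hX : ∀ i, IsStrictlyPositive (X i)) =>
      ⟨segment_isStrictlyPositive (hX 0) (hX 1) hs, hX 2⟩) hconv

theorem segmentMean_nonneg {p : ℝ} (hp : 0 < p) (X : Fin 3 → B) : 0 ≤ segmentMean p X :=
  smul_nonneg (by linarith) (integral_nonneg fun _ => geomMean_nonneg _ _ _)

end SegmentMean

/-! ### Evaluation on commuting elements -/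

section Characters

open Set MeasureTheory WeakDual

universe u
variable {k : ℕ}

/-- A commuting self-adjoint tuple `X` is the image of a tuple `x` of a commutative C⋆-algebra, and
`f (X₁, …, X_k)` is the image of any `y` such that `χ y = f (χ x₁, …, χ x_k)` for every character
`χ`. The existence of such a `y` makes the function of `χ` on the right continuous, so the junk
value in the definition of `jointCFC` does not occur. -/
theorem exists_commCStarAlgebra_jointCFC {A : Type u} [CStarAlgebra A] {X : Fin k → A}
    (h : IsCommutingSelfAdjoint X) :
    ∃ (D : Type u) (_ : CommCStarAlgebra D) (ι : D →⋆ₐ[ℂ] A) (x : Fin k → D),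
      Function.Injective ι ∧ (∀ i, ι (x i) = X i) ∧
      ∀ (f : (Fin k → ℝ) → ℝ) (y : D),
        (∀ χ : characterSpace ℂ D, χ y = ((f fun i => (χ (x i)).re : ℝ) : ℂ)) →
          jointCFC f X = ι y := by
  let _ := jointAlgebraCommCStarAlgebra h
  refine ⟨jointAlgebra X, inferInstance, (jointAlgebra X).subtype,
    fun i => ⟨X i, mem_jointAlgebra X i⟩, Subtype.val_injective, fun i => rfl, fun f y hy => ?_⟩
  have hfun : (fun χ : characterSpace ℂ (jointAlgebra X) =>
      ((f fun i => (χ ⟨X i, mem_jointAlgebra X i⟩).re : ℝ) : ℂ)) =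
      gelfandStarTransform (jointAlgebra X) y := funext fun χ => (hy χ).symm
  have hc : Continuous (fun χ : characterSpace ℂ (jointAlgebra X) =>
      ((f fun i => (χ ⟨X i, mem_jointAlgebra X i⟩).re : ℝ) : ℂ)) := by
    rw [hfun]; exact map_continuous _
  have hy' : (⟨_, hc⟩ : C(characterSpace ℂ (jointAlgebra X), ℂ)) =
      gelfandStarTransform (jointAlgebra X) y := ContinuousMap.ext fun χ => (hy χ).symm
  rw [jointCFC, dif_pos h]
  refine (dif_pos hc).trans ?_
  rw [hy']
  exact congrArg Subtype.val ((gelfandStarTransform (jointAlgebra X)).symm_apply_apply y)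

variable {D : Type*} [CommCStarAlgebra D]

theorem eq_of_forall_character {x y : D} (h : ∀ χ : characterSpace ℂ D, χ x = χ y) : x = y :=
  (gelfandTransform_bijective D).1 (ContinuousMap.ext h)

theorem character_re_mem_spectrum {x : D} (hx : IsSelfAdjoint x) (χ : characterSpace ℂ D) :
    ((χ x).re : ℂ) = χ x ∧ (χ x).re ∈ spectrum ℝ x := by
  have h1 : IsSelfAdjoint (χ x) := hx.map χ
  have h2 : ((χ x).re : ℂ) = χ x := Complex.conj_eq_iff_re.mp h1
  refine ⟨h2, ?_⟩
  rw [← spectrum.algebraMap_mem_iff ℂ, Complex.coe_algebraMap, h2]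
  exact CharacterSpace.apply_mem_spectrum χ x

theorem character_cfc {x : D} (hx : IsSelfAdjoint x) (χ : characterSpace ℂ D) {f : ℝ → ℝ}
    (hf : ContinuousOn f (spectrum ℝ x)) : χ (cfc f x) = (f (χ x).re : ℝ) := by
  have h := StarAlgHomClass.map_cfc (S := ℂ) χ f x hf (map_continuous χ) hx (hx.map χ)
  rw [h, ← (character_re_mem_spectrum hx χ).1]
  exact (cfc_algebraMap (A := ℂ) (χ x).re f).trans rfl

variable {B : Type*} [CStarAlgebra B] [PartialOrder B] [StarOrderedRing B]
  {ι : D →⋆ₐ[ℂ] B}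

omit [PartialOrder B] [StarOrderedRing B] in
theorem isSelfAdjoint_of_map (hι : Function.Injective ι) {x : D} (hx : IsSelfAdjoint (ι x)) :
    IsSelfAdjoint x :=
  hι (by rw [map_star]; exact hx)

theorem spectrum_subset_Ioi_of_map (hι : Function.Injective ι) {x : D}
    (hx : IsStrictlyPositive (ι x)) : spectrum ℝ x ⊆ Ioi 0 := by
  rw [← (isSelfAdjoint_of_map hι hx.isSelfAdjoint).map_spectrum_real ι hι]
  exact (StarOrderedRing.isStrictlyPositive_iff_spectrum_pos (R := ℝ) (ι x) hx.isSelfAdjoint).mp hx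

theorem continuousOn_rpow_const_spectrum (hι : Function.Injective ι) {x : D}
    (hx : IsStrictlyPositive (ι x)) (r : ℝ) :
    ContinuousOn (fun t : ℝ => t ^ r) (spectrum ℝ x) :=
  continuousOn_id.rpow_const fun _ ht => .inl (spectrum_subset_Ioi_of_map hι hx ht).ne'

theorem map_rpow_eq (hι : Function.Injective ι) {x : D} (hx : IsStrictlyPositive (ι x)) (r : ℝ) :
    (ι x) ^ r = ι (cfc (fun t : ℝ => t ^ r) x) := by
  rw [CFC.rpow_eq_cfc_real hx.nonneg]
  exact (StarAlgHom.map_cfc (S := ℂ) ι _ x (continuousOn_rpow_const_spectrum hι hx r)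
    (NonUnitalStarAlgHom.isometry ι hι).continuous (isSelfAdjoint_of_map hι hx.isSelfAdjoint)
    hx.isSelfAdjoint).symm

theorem character_re_pos (hι : Function.Injective ι) {x : D} (hx : IsStrictlyPositive (ι x))
    (χ : characterSpace ℂ D) : 0 < (χ x).re :=
  spectrum_subset_Ioi_of_map hι hx
    (character_re_mem_spectrum (isSelfAdjoint_of_map hι hx.isSelfAdjoint) χ).2

theorem character_rpow (hι : Function.Injective ι) {x : D} (hx : IsStrictlyPositive (ι x)) (r : ℝ)
    (χ : characterSpace ℂ D) :
    χ (cfc (fun t : ℝ => t ^ r) x) = (((χ x).re ^ r : ℝ) : ℂ) :=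
  character_cfc (isSelfAdjoint_of_map hι hx.isSelfAdjoint) χ
    (continuousOn_rpow_const_spectrum hι hx r)

/-- For commuting elements the identity reduces to one of positive real numbers, by evaluation at
the characters of the commutative C⋆-algebra which the two elements generate. -/
theorem geomMean_of_commute {a c : B} (ha : IsStrictlyPositive a) (hc : IsStrictlyPositive c)
    (hac : Commute a c) (p : ℝ) : geomMean p a c = a ^ p * c ^ (1 - p) := by
  have hX : IsCommutingSelfAdjoint ![a, c] := by
    refine ⟨fun i => ?_, fun i j => ?_⟩
    · fin_cases i
      exacts [ha.isSelfAdjoint, hc.isSelfAdjoint]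
    · fin_cases i <;> fin_cases j
      exacts [Commute.refl _, hac, hac.symm, Commute.refl _]
  obtain ⟨D, _, ι, x, hι, hx, -⟩ := exists_commCStarAlgebra_jointCFC hX
  obtain rfl : ι (x 0) = a := hx 0
  obtain rfl : ι (x 1) = c := hx 1
  have hk := isStrictlyPositive_conj_rpow_neg_half ha hc
  rw [geomMean, map_rpow_eq hι hc, map_rpow_eq hι hc, map_rpow_eq hι hc, map_rpow_eq hι ha]
  rw [map_rpow_eq hι hc, ← map_mul, ← map_mul] at hk
  rw [← map_mul, ← map_mul, map_rpow_eq hι hk]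
  simp only [← map_mul]
  congr 1
  refine eq_of_forall_character fun χ => ?_
  simp only [map_mul, character_rpow hι hk, character_rpow hι ha, character_rpow hι hc]
  have h0 := character_re_pos hι ha χ
  have h1 := character_re_pos hι hc χ
  rw [← (character_re_mem_spectrum (isSelfAdjoint_of_map hι ha.isSelfAdjoint) χ).1]
  norm_cast
  set s := (χ (x 0)).re
  set t := (χ (x 1)).re
  have e : t ^ (-(1 / 2) : ℝ) * s * t ^ (-(1 / 2) : ℝ) = s * t⁻¹ := by
    rw [mul_comm, ← mul_assoc, ← Real.rpow_add h1]
    norm_num [Real.rpow_neg_one, mul_comm]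
  rw [e, Real.mul_rpow h0.le (inv_nonneg.mpr h1.le), Real.inv_rpow h1.le, Real.rpow_sub h1,
    Real.rpow_one, mul_comm, ← mul_assoc, ← Real.rpow_add h1]
  norm_num
  ring

theorem threeVarFun_eq_integral {p : ℝ} (hp : 0 < p) {t : Fin 3 → ℝ} :
    threeVarFun p t =
      (p + 1) * (∫ s in Icc (0 : ℝ) 1, (s * t 0 + (1 - s) * t 1) ^ p) * t 2 ^ (1 - p) := by
  rw [integral_Icc_eq_integral_Ioc, ← intervalIntegral.integral_of_le zero_le_one, threeVarFun]
  split_ifs with h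
  · have : ∀ s : ℝ, s * t 0 + (1 - s) * t 1 = t 0 := fun s => by rw [h]; ring
    simp [this]
  · have hne : t 0 - t 1 ≠ 0 := sub_ne_zero.mpr h
    have : ∀ s : ℝ, s * t 0 + (1 - s) * t 1 = (t 0 - t 1) * s + t 1 := fun s => by ring
    simp only [this]
    rw [intervalIntegral.integral_comp_mul_add (fun x : ℝ => x ^ p) hne,
      integral_rpow (.inl (by linarith))]
    have : p + 1 ≠ 0 := by linarith
    simp only [mul_zero, zero_add, mul_one, sub_add_cancel, smul_eq_mul]
    field_simp

/-- Both sides are the image of one element `y` of a commutative C⋆-algebra: the characters commute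
with the integral, which turns `y` into `threeVarFun p`, and so does the inclusion. -/
theorem segmentMean_eq_jointCFC {p : ℝ} (hp : 0 < p) {X : Fin 3 → B}
    (hX : ∀ i, IsStrictlyPositive (X i)) (hcomm : ∀ i j, Commute (X i) (X j)) :
    segmentMean p X = jointCFC (threeVarFun p) X := by
  obtain ⟨D, _, ι, x, hι, hx, hf⟩ :=
    exists_commCStarAlgebra_jointCFC (X := X) ⟨fun i => (hX i).isSelfAdjoint, hcomm⟩
  have hxp : ∀ i, IsStrictlyPositive (ι (x i)) := fun i => by rw [hx]; exact hX i
  have hseg : ∀ s ∈ Icc (0 : ℝ) 1, IsStrictlyPositive (ι (s • x 0 + (1 - s) • x 1)) := by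
    intro s hs
    have : ι (s • x 0 + (1 - s) • x 1) = s • ι (x 0) + (1 - s) • ι (x 1) := by
      rw [map_add, ← Complex.coe_smul, ← Complex.coe_smul, map_smul, map_smul, Complex.coe_smul,
        Complex.coe_smul]
    rw [this]
    exact segment_isStrictlyPositive (hxp 0) (hxp 1) hs
  let g : ℝ → D := fun s => cfc (fun t : ℝ => t ^ p) (s • x 0 + (1 - s) • x 1)
  have hg : IntegrableOn g (Icc 0 1) := by
    refine ContinuousOn.integrableOn_Icc ?_
    exact ContinuousOn.cfc_of_mem_nhdsSet (s := univ) _ Filter.univ_mem (by fun_prop)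
      (fun s hs => isSelfAdjoint_of_map hι (hseg s hs).isSelfAdjoint)
      (Real.continuous_rpow_const hp.le).continuousOn
  let y : D := (p + 1) • ((∫ s in Icc (0 : ℝ) 1, g s) * cfc (fun t : ℝ => t ^ (1 - p)) (x 2))
  rw [hf (threeVarFun p) y]
  · let ι' : D →L[ℝ] B :=
      ⟨(ι : D →ₗ[ℂ] B).restrictScalars ℝ, (NonUnitalStarAlgHom.isometry ι hι).continuous⟩
    have hι' : ∀ z, ι' z = ι z := fun _ => rfl
    rw [← hι', map_smul, hι', map_mul, ← map_rpow_eq hι (hxp 2), hx, ← hι',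
      ← ι'.integral_comp_comm hg, segmentMean, ← integral_mul_const_of_integrable]
    · congr 1
      refine setIntegral_congr_fun measurableSet_Icc fun s hs => ?_
      simp only [hι']
      rw [← map_rpow_eq hι (hseg s hs), ← hι', map_add, map_smul, map_smul, hι', hι', hx, hx]
      refine geomMean_of_commute (segment_isStrictlyPositive (hX 0) (hX 1) hs) (hX 2) ?_ p
      exact ((hcomm 0 2).smul_left s).add_left ((hcomm 1 2).smul_left (1 - s))
    · exact ι'.integrable_comp hg
  · intro χ
    let χ' : D →L[ℝ] ℂ := (CharacterSpace.toCLM χ).restrictScalars ℝ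
    have hχ' : ∀ z, χ' z = χ z := fun _ => rfl
    rw [← hχ', map_smul, hχ', map_mul, character_rpow hι (hxp 2), ← hχ',
      ← χ'.integral_comp_comm hg, threeVarFun_eq_integral hp]
    have : ∫ s in Icc (0 : ℝ) 1, χ' (g s) = ∫ s in Icc (0 : ℝ) 1,
        (((s * (χ (x 0)).re + (1 - s) * (χ (x 1)).re) ^ p : ℝ) : ℂ) := by
      refine setIntegral_congr_fun measurableSet_Icc fun s hs => ?_
      simp only [hχ', g]
      rw [character_rpow hι (hseg s hs), ← hχ', map_add, map_smul, map_smul]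
      simp [hχ']
    rw [this, integral_complex_ofReal]
    simp [mul_assoc]

end Characters

/-! ### Lieb's concavity theorem -/

section Lieb

theorem finite_spectrum_real (A : Type*) [CStarAlgebra A] [FiniteDimensional ℂ A] (a : A) :
    (spectrum ℝ a).Finite := by
  have : FiniteDimensional ℝ A := FiniteDimensional.complexToReal A
  have hint : IsIntegral ℝ a := Algebra.IsIntegral.isIntegral a
  refine (minpoly ℝ a).roots.toFinset.finite_toSet.subset fun t ht => ?_
  have h := spectrum.subset_polynomial_aeval a (minpoly ℝ a) ⟨t, ht, rfl⟩
  rw [minpoly.aeval] at h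
  have : Nontrivial A := by
    by_contra hA
    rw [not_nontrivial_iff_subsingleton] at hA
    simp [spectrum.of_subsingleton] at ht
  rw [spectrum.zero_eq] at h
  simpa [minpoly.ne_zero hint] using h

/-- A linear map that preserves powers preserves real powers: in finite dimension `t ↦ t ^ r`
coincides with a polynomial on the two spectra. This covers homomorphisms and
antihomomorphisms. -/
theorem map_rpow_of_map_pow {A B : Type*} [CStarAlgebra A] [PartialOrder A] [StarOrderedRing A]
    [CStarAlgebra B] [PartialOrder B] [StarOrderedRing B] [FiniteDimensional ℂ A]
    [FiniteDimensional ℂ B] (T : A →ₗ[ℂ] B) (hpow : ∀ a n, T (a ^ n) = T a ^ n) {a : A}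
    (ha : IsStrictlyPositive a) (hTa : IsStrictlyPositive (T a)) (r : ℝ) :
    T (a ^ r) = T a ^ r := by
  classical
  have hfin := finite_spectrum_real A a
  have hfin' := finite_spectrum_real B (T a)
  let s : Finset ℝ := hfin.toFinset ∪ hfin'.toFinset
  let q : Polynomial ℝ := Lagrange.interpolate s id fun t => t ^ r
  have hq : ∀ t ∈ s, q.eval t = t ^ r := fun t ht =>
    Lagrange.eval_interpolate_at_node (v := id) (fun t => t ^ r) Function.injective_id.injOn ht
  have h1 : a ^ r = Polynomial.aeval a q := by
    rw [CFC.rpow_eq_cfc_real ha.nonneg, ← cfc_polynomial q a ha.isSelfAdjoint]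
    exact cfc_congr fun t ht => (hq t (by simp [s, ht])).symm
  have h2 : T a ^ r = Polynomial.aeval (T a) q := by
    rw [CFC.rpow_eq_cfc_real hTa.nonneg, ← cfc_polynomial q (T a) hTa.isSelfAdjoint]
    exact cfc_congr fun t ht => (hq t (by simp [s, ht])).symm
  rw [h1, h2, Polynomial.aeval_eq_sum_range, Polynomial.aeval_eq_sum_range, map_sum]
  refine Finset.sum_congr rfl fun i _ => ?_
  rw [← Complex.coe_smul, map_smul, hpow, Complex.coe_smul]

/-- A nonnegative element is the square of a self-adjoint one, and squares of self-adjoint elements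
are preserved. -/
theorem map_isStrictlyPositive_of_map_pow {A B : Type*} [CStarAlgebra A] [PartialOrder A]
    [StarOrderedRing A] [CStarAlgebra B] [PartialOrder B] [StarOrderedRing B] (T : A →ₗ[ℂ] B)
    (hpow : ∀ a n, T (a ^ n) = T a ^ n) (hstar : ∀ a, T (star a) = star (T a))
    (hunit : ∀ a, IsUnit a → IsUnit (T a)) {a : A} (ha : IsStrictlyPositive a) :
    IsStrictlyPositive (T a) := by
  refine (hunit a ha.isUnit).isStrictlyPositive ?_
  obtain ⟨b, hb, rfl⟩ :=
    CStarAlgebra.nonneg_iff_exists_isSelfAdjoint_and_eq_mul_self.mp ha.nonneg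
  have hTb : IsSelfAdjoint (T b) := by rw [IsSelfAdjoint, ← hstar, hb.star_eq]
  rw [← sq, hpow, sq]
  exact hTb.mul_self_nonneg

variable {H : Type*} [NormedAddCommGroup H] [InnerProductSpace ℂ H]

theorem trace_mul_comm_clm (X Y : H →L[ℂ] H) :
    LinearMap.trace ℂ H (X * Y : H →L[ℂ] H) = LinearMap.trace ℂ H (Y * X : H →L[ℂ] H) :=
  LinearMap.trace_mul_comm ℂ (X : H →ₗ[ℂ] H) (Y : H →ₗ[ℂ] H)

variable (H) in
/-- The Hilbert space of Hilbert–Schmidt operators on the finite-dimensional space `H`. An operator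
`X` is encoded as the tuple of the vectors `X eᵢ`, with `e` the standard orthonormal basis. -/
abbrev HilbertSchmidt [FiniteDimensional ℂ H] : Type _ :=
  PiLp 2 fun _ : Fin (Module.finrank ℂ H) => H

variable [FiniteDimensional ℂ H]

/-- The operator `X` as a vector of the Hilbert–Schmidt space. -/
noncomputable def toHilbertSchmidt : (H →L[ℂ] H) ≃ₗ[ℂ] HilbertSchmidt H :=
  (LinearMap.toContinuousLinearMap (𝕜 := ℂ) (E := H) (F' := H)).symm ≪≫ₗ
    ((stdOrthonormalBasis ℂ H).toBasis.constr ℂ).symm ≪≫ₗ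
      (WithLp.linearEquiv 2 ℂ (Fin (Module.finrank ℂ H) → H)).symm

theorem toHilbertSchmidt_apply (X : H →L[ℂ] H) (i : Fin (Module.finrank ℂ H)) :
    toHilbertSchmidt X i = X (stdOrthonormalBasis ℂ H i) := by
  simp [toHilbertSchmidt, Module.Basis.constr]

/-- A linear map on `B(H)` as an operator on the Hilbert–Schmidt space. -/
noncomputable def hilbertSchmidtOp :
    Module.End ℂ (H →L[ℂ] H) ≃ₐ[ℂ] (HilbertSchmidt H →L[ℂ] HilbertSchmidt H) :=
  (toHilbertSchmidt.conjAlgEquiv ℂ).trans (Module.End.toContinuousLinearMap (HilbertSchmidt H))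

theorem hilbertSchmidtOp_apply (S : Module.End ℂ (H →L[ℂ] H)) (X : H →L[ℂ] H) :
    hilbertSchmidtOp S (toHilbertSchmidt X) = toHilbertSchmidt (S X) := by
  change toHilbertSchmidt (S (toHilbertSchmidt.symm (toHilbertSchmidt X))) = _
  rw [LinearEquiv.symm_apply_apply]

/-- Left multiplication `X ↦ a X` as an operator on the Hilbert–Schmidt space. -/
noncomputable def leftMulOp : (H →L[ℂ] H) →ₗ[ℂ] (HilbertSchmidt H →L[ℂ] HilbertSchmidt H) :=
  hilbertSchmidtOp.toLinearMap ∘ₗ LinearMap.mul ℂ (H →L[ℂ] H)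

/-- Right multiplication `X ↦ X a` as an operator on the Hilbert–Schmidt space. -/
noncomputable def rightMulOp : (H →L[ℂ] H) →ₗ[ℂ] (HilbertSchmidt H →L[ℂ] HilbertSchmidt H) :=
  hilbertSchmidtOp.toLinearMap ∘ₗ (LinearMap.mul ℂ (H →L[ℂ] H)).flip

theorem leftMulOp_eq (a : H →L[ℂ] H) : leftMulOp a = hilbertSchmidtOp (LinearMap.mulLeft ℂ a) :=
  rfl

theorem rightMulOp_eq (a : H →L[ℂ] H) :
    rightMulOp a = hilbertSchmidtOp (LinearMap.mulRight ℂ a) := rfl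

theorem commute_leftMulOp_rightMulOp (a c : H →L[ℂ] H) : Commute (leftMulOp a) (rightMulOp c) :=
  (LinearMap.commute_mulLeft_right (R := ℂ) a c).map hilbertSchmidtOp

theorem leftMulOp_pow (a : H →L[ℂ] H) (n : ℕ) : leftMulOp (a ^ n) = leftMulOp a ^ n := by
  rw [leftMulOp_eq, leftMulOp_eq, ← map_pow, LinearMap.pow_mulLeft]

theorem rightMulOp_pow (a : H →L[ℂ] H) (n : ℕ) : rightMulOp (a ^ n) = rightMulOp a ^ n := by
  rw [rightMulOp_eq, rightMulOp_eq, ← map_pow, LinearMap.pow_mulRight]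

theorem leftMulOp_isUnit {a : H →L[ℂ] H} (ha : IsUnit a) : IsUnit (leftMulOp a) :=
  (ha.map (Algebra.lmul ℂ (H →L[ℂ] H))).map hilbertSchmidtOp

theorem rightMulOp_isUnit {a : H →L[ℂ] H} (ha : IsUnit a) : IsUnit (rightMulOp a) := by
  obtain ⟨u, rfl⟩ := ha
  have h (x y : H →L[ℂ] H) (hxy : x * y = 1) : rightMulOp y * rightMulOp x = 1 := by
    rw [rightMulOp_eq, rightMulOp_eq, ← map_mul, Module.End.mul_eq_comp, ← LinearMap.mulRight_mul,
      hxy, LinearMap.mulRight_one]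
    exact map_one _
  exact ⟨⟨_, _, h _ _ u.inv_mul, h _ _ u.mul_inv⟩, rfl⟩

variable [CompleteSpace H]

theorem inner_toHilbertSchmidt (X Y : H →L[ℂ] H) :
    inner ℂ (toHilbertSchmidt X) (toHilbertSchmidt Y) =
      LinearMap.trace ℂ H (star X * Y : H →L[ℂ] H) := by
  rw [LinearMap.trace_eq_sum_inner _ (stdOrthonormalBasis ℂ H), PiLp.inner_apply]
  refine Finset.sum_congr rfl fun i _ => ?_
  rw [toHilbertSchmidt_apply, toHilbertSchmidt_apply]
  simp [ContinuousLinearMap.star_eq_adjoint, ContinuousLinearMap.adjoint_inner_right]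

theorem star_hilbertSchmidtOp {S S' : Module.End ℂ (H →L[ℂ] H)}
    (h : ∀ X Y : H →L[ℂ] H, LinearMap.trace ℂ H (star (S X) * Y : H →L[ℂ] H) =
      LinearMap.trace ℂ H (star X * S' Y : H →L[ℂ] H)) :
    hilbertSchmidtOp S' = star (hilbertSchmidtOp S) := by
  rw [ContinuousLinearMap.star_eq_adjoint, ContinuousLinearMap.eq_adjoint_iff]
  intro x y
  obtain ⟨X, rfl⟩ := toHilbertSchmidt.surjective x
  obtain ⟨Y, rfl⟩ := toHilbertSchmidt.surjective y
  rw [hilbertSchmidtOp_apply, hilbertSchmidtOp_apply, ← inner_conj_symm, inner_toHilbertSchmidt,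
    ← h Y X, ← inner_toHilbertSchmidt, inner_conj_symm]

theorem leftMulOp_star (a : H →L[ℂ] H) : leftMulOp (star a) = star (leftMulOp a) := by
  refine star_hilbertSchmidtOp fun X Y => ?_
  simp [mul_assoc]

theorem rightMulOp_star (a : H →L[ℂ] H) : rightMulOp (star a) = star (rightMulOp a) := by
  refine star_hilbertSchmidtOp fun X Y => ?_
  simp only [LinearMap.flip_apply, LinearMap.mul_apply', star_mul]
  rw [mul_assoc, trace_mul_comm_clm, mul_assoc]

theorem leftMulOp_isStrictlyPositive {a : H →L[ℂ] H} (ha : IsStrictlyPositive a) :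
    IsStrictlyPositive (leftMulOp a) :=
  map_isStrictlyPositive_of_map_pow leftMulOp leftMulOp_pow leftMulOp_star
    (fun _ => leftMulOp_isUnit) ha

theorem rightMulOp_isStrictlyPositive {a : H →L[ℂ] H} (ha : IsStrictlyPositive a) :
    IsStrictlyPositive (rightMulOp a) :=
  map_isStrictlyPositive_of_map_pow rightMulOp rightMulOp_pow rightMulOp_star
    (fun _ => rightMulOp_isUnit) ha

theorem leftMulOp_rpow {a : H →L[ℂ] H} (ha : IsStrictlyPositive a) (r : ℝ) :
    leftMulOp (a ^ r) = leftMulOp a ^ r :=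
  map_rpow_of_map_pow leftMulOp leftMulOp_pow ha (leftMulOp_isStrictlyPositive ha) r

theorem rightMulOp_rpow {a : H →L[ℂ] H} (ha : IsStrictlyPositive a) (r : ℝ) :
    rightMulOp (a ^ r) = rightMulOp a ^ r :=
  map_rpow_of_map_pow rightMulOp rightMulOp_pow ha (rightMulOp_isStrictlyPositive ha) r

theorem inner_leftMulOp_rightMulOp (K a c : H →L[ℂ] H) :
    inner ℂ (toHilbertSchmidt K) ((leftMulOp a * rightMulOp c) (toHilbertSchmidt K)) =
      LinearMap.trace ℂ H (ContinuousLinearMap.adjoint K * a * K * c : H →L[ℂ] H) := by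
  have h : (leftMulOp a * rightMulOp c) (toHilbertSchmidt K) = toHilbertSchmidt (a * (K * c)) := by
    rw [mul_apply_eq_comp, rightMulOp_eq, leftMulOp_eq, hilbertSchmidtOp_apply,
      hilbertSchmidtOp_apply]
    rfl
  rw [h, inner_toHilbertSchmidt, ContinuousLinearMap.star_eq_adjoint, mul_assoc, mul_assoc]

theorem inner_geomMean_eq_trace {p : ℝ} {a c : H →L[ℂ] H} (ha : IsStrictlyPositive a)
    (hc : IsStrictlyPositive c) (K : H →L[ℂ] H) :
    inner ℂ (toHilbertSchmidt K)
        (geomMean p (leftMulOp a) (rightMulOp c) (toHilbertSchmidt K)) =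
      LinearMap.trace ℂ H
        (ContinuousLinearMap.adjoint K * a ^ p * K * c ^ (1 - p) : H →L[ℂ] H) := by
  rw [geomMean_of_commute (leftMulOp_isStrictlyPositive ha) (rightMulOp_isStrictlyPositive hc)
    (commute_leftMulOp_rightMulOp a c), ← leftMulOp_rpow ha, ← rightMulOp_rpow hc,
    inner_leftMulOp_rightMulOp]

theorem ConcaveOn.re_inner {E V : Type*} [NormedAddCommGroup E] [InnerProductSpace ℂ E]
    [AddCommGroup V] [Module ℝ V] {s : Set V} {f : V → E →L[ℂ] E} (hf : ConcaveOn ℝ s f) (x : E) :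
    ConcaveOn ℝ s fun v => (inner ℂ x (f v x)).re := by
  refine ⟨hf.1, fun v hv w hw a b ha hb hab => ?_⟩
  have h := (ContinuousLinearMap.le_def _ _).mp (hf.2 hv hw ha hb hab)
  have h' := h.re_inner_nonneg_right x
  simp only [sub_apply, add_apply, smul_apply, inner_sub_right, inner_add_right, map_sub, map_add,
    ← Complex.coe_smul, inner_smul_right, RCLike.re_to_complex, Complex.re_ofReal_mul] at h'
  simpa only [smul_eq_mul] using sub_nonneg.mp h'

/-- Lieb's concavity theorem. -/
theorem concaveOn_trace_rpow {p : ℝ} (hp0 : 0 < p) (hp1 : p ≤ 1) (K : H →L[ℂ] H) :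
    ConcaveOn ℝ (posTuples H 2) (fun X =>
      (LinearMap.trace ℂ H
        (ContinuousLinearMap.adjoint K * X 0 ^ p * K * X 1 ^ (1 - p) : H →L[ℂ] H)).re) := by
  have hconv : Convex ℝ (posTuples H 2) := fun X hX Y hY a b ha hb hab i =>
    convex_isStrictlyPositive (hX i) (hY i) ha hb hab
  let g : (Fin 2 → (H →L[ℂ] H)) →ₗ[ℝ]
      (HilbertSchmidt H →L[ℂ] HilbertSchmidt H) × (HilbertSchmidt H →L[ℂ] HilbertSchmidt H) :=
    LinearMap.prod (leftMulOp.restrictScalars ℝ ∘ₗ LinearMap.proj 0)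
      (rightMulOp.restrictScalars ℝ ∘ₗ LinearMap.proj 1)
  refine ConcaveOn.congr ((((concaveOn_geomMean hp0 hp1).comp_linearMap g).subset
    (fun X (hX : ∀ i, IsStrictlyPositive (X i)) => ?_) hconv).re_inner (toHilbertSchmidt K)) ?_
  · exact ⟨leftMulOp_isStrictlyPositive (hX 0), rightMulOp_isStrictlyPositive (hX 1)⟩
  · exact fun X hX => congrArg Complex.re (inner_geomMean_eq_trace (hX 0) (hX 1) K)

end Lieb

/-! ### Operator concavity -/

theorem operatorConcaveOn_threeVarFun (H : Type*) [NormedAddCommGroup H] [InnerProductSpace ℂ H]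
    [CompleteSpace H] {p : ℝ} (hp0 : 0 < p) (hp1 : p ≤ 1) :
    OperatorConcaveOn H (fun _ : Fin 3 => Set.Ioi (0 : ℝ)) (threeVarFun p) := by
  intro 𝒜 _ hcomm
  have hpos : ∀ X : Fin 3 → (H →L[ℂ] H),
      (∀ i, X i ∈ 𝒜 i ∧ IsSelfAdjoint (X i) ∧ spectrum ℝ (X i) ⊆ Set.Ioi 0) ↔
        (∀ i, X i ∈ 𝒜 i) ∧ ∀ i, IsStrictlyPositive (X i) := fun X => by
    rw [← forall_and]
    refine forall_congr' fun i => and_congr_right fun _ => ⟨fun h => ?_, fun h => ?_⟩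
    · exact (StarOrderedRing.isStrictlyPositive_iff_spectrum_pos (R := ℝ) _ h.1).mpr h.2
    · exact ⟨h.isSelfAdjoint,
        (StarOrderedRing.isStrictlyPositive_iff_spectrum_pos (R := ℝ) _ h.isSelfAdjoint).mp h⟩
  simp only [hpos]
  refine ConcaveOn.congr (f := segmentMean p) ?_ ?_
  · refine (concaveOn_segmentMean hp0 hp1).subset (fun X hX => hX.2) ?_
    intro X hX Y hY a b ha hb hab
    refine ⟨fun i => ?_, fun i => convex_isStrictlyPositive (hX.2 i) (hY.2 i) ha hb hab⟩
    have hsmul (r : ℝ) {Z : H →L[ℂ] H} (hZ : Z ∈ 𝒜 i) : r • Z ∈ 𝒜 i := by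
      rw [← Complex.coe_smul]; exact SMulMemClass.smul_mem _ hZ
    exact add_mem (hsmul a (hX.1 i)) (hsmul b (hY.1 i))
  · intro X hX
    refine segmentMean_eq_jointCFC hp0 hX.2 fun i j => ?_
    rcases eq_or_ne i j with rfl | hij
    · exact Commute.refl _
    · exact hcomm i j hij _ (hX.1 i) _ (hX.1 j)

theorem mainTheorem6 {H : Type*} [NormedAddCommGroup H] [InnerProductSpace ℂ H] [CompleteSpace H]
    (p : ℝ) (hp0 : 0 < p) (hp1 : p ≤ 1) :
    (∃ Φ : (Fin 3 → (H →L[ℂ] H)) → (H →L[ℂ] H),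
      (∀ X ∈ posTuples H 3, IsSelfAdjoint (Φ X)) ∧
      ConcaveOn ℝ (posTuples H 3) Φ ∧
      ∀ X ∈ posTuples H 3, (∀ i j, Commute (X i) (X j)) → Φ X = jointCFC (threeVarFun p) X) ∧
    OperatorConcaveOn H (fun _ : Fin 3 => Set.Ioi (0 : ℝ)) (threeVarFun p) ∧
    (FiniteDimensional ℂ H → ∀ K : H →L[ℂ] H,
      ConcaveOn ℝ (posTuples H 2) (fun X =>
        (LinearMap.trace ℂ H
          (ContinuousLinearMap.adjoint K * X 0 ^ p * K * X 1 ^ (1 - p) : H →L[ℂ] H)).re)) :=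
  ⟨⟨segmentMean p, fun X _ => (segmentMean_nonneg hp0 X).isSelfAdjoint,
      concaveOn_segmentMean hp0 hp1, fun _ hX hcomm => segmentMean_eq_jointCFC hp0 hX hcomm⟩,
    operatorConcaveOn_threeVarFun H hp0 hp1, fun _ K => concaveOn_trace_rpow hp0 hp1 K⟩
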